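/- Let $\mathcal{A}$ be a Grothendieck category and let $G$ be a nonzero noetherian generator of $\mathcal{A}$ (so that $\mathcal{A}$ is strongly locally noetherian via $G$). For an object $A$ let $K(A)$ denote its Gabriel–Rentschler Krull dimension, that is, the deviation of the poset of subobjects of $A$ (equal to $-1$ if $A=0$, and to $\infty$ if no deviation exists). A nonzero object $A$ is called critical if $K(A)$ is an ordinal and $K(A/B)<K(A)$ for every nonzero subobject $B$ of $A$. The critical dimension $\mathrm{cd}(A)$ of a nonzero object $A$ is the minimum of $K(B)$ over the nonzero subobjects $B$ of $A$. A critical composition series of $A$ is a finite chain of subobjects $0=A_0<A_1<\dots<A_n=A$ such that every factor $A_{i+1}/A_i$ is critical and $K(A_{i+1}/A_i)\le K(A_{i+2}/A_{i+1})$ for all $i$. Then $d=K(G)$ is an ordinal, and, up to isomorphism, there is at least one, and there are only finitely many, indecomposable injective objects $E$ of $\mathcal{A}$ with $\mathrm{cd}(E)=d$. Moreover, $G$ has a critical composition series, and for every critical composition series $0=G_0<G_1<\dots<G_n=G$ of $G$, every factor $G_{i+1}/G_i$ with $K(G_{i+1}/G_i)=d$ has an injective hull, and an object $E$ of $\mathcal{A}$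 is an indecomposable injective object with $\mathrm{cd}(E)=d$ if and only if $E$ is an injective hull of some factor $G_{i+1}/G_i$ with $K(G_{i+1}/G_i)=d$. -/

import Mathlib

open CategoryTheory CategoryTheory.Limits

universe w v u

/-! ### Deviation of a partially ordered set -/

/-- `DeviationGE α P`: the poset `P` has deviation at least `α`, i.e. `P` is not trivial (it has two
comparable distinct elements) and, for every `β < α`, there is a strictly descending sequence
`f 0 > f 1 > ...` all of whose factors `[f (i + 1), f i]` have deviation at least `β`.
The lemmas `deviationGE_zero`, `deviationGE_succ` and `deviationGE_limit` below give the usual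
clauses of the transfinite recursion. -/
def DeviationGE (α : Ordinal.{w}) (P : Type u) [PartialOrder P] : Prop :=
  (∃ a b : P, a < b) ∧
    ∀ β : Ordinal.{w}, β < α →
      ∃ f : ℕ → P, StrictAnti f ∧ ∀ i, DeviationGE β (Set.Icc (f (i + 1)) (f i))
termination_by α

theorem deviationGE_iff (α : Ordinal.{w}) (P : Type u) [PartialOrder P] :
    DeviationGE α P ↔ (∃ a b : P, a < b) ∧
      ∀ β : Ordinal.{w}, β < α →
        ∃ f : ℕ → P, StrictAnti f ∧ ∀ i, DeviationGE β (Set.Icc (f (i + 1)) (f i)) := by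
  rw [DeviationGE]

theorem DeviationGE.mono {α β : Ordinal.{w}} (h : β ≤ α) {P : Type u} [PartialOrder P]
    (hP : DeviationGE α P) : DeviationGE β P := by
  rw [deviationGE_iff] at hP ⊢
  exact ⟨hP.1, fun γ hγ => hP.2 γ (hγ.trans_le h)⟩

/-- Deviation at least `0` means not trivial. -/
theorem deviationGE_zero (P : Type u) [PartialOrder P] :
    DeviationGE (0 : Ordinal.{w}) P ↔ ∃ a b : P, a < b := by
  rw [deviationGE_iff]
  exact ⟨fun h => h.1, fun h => ⟨h, fun β hβ => absurd hβ not_lt_zero⟩⟩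

/-- Deviation at least `α + 1`: there is an infinite strictly descending sequence all of whose
factors have deviation at least `α`. -/
theorem deviationGE_succ (α : Ordinal.{w}) (P : Type u) [PartialOrder P] :
    DeviationGE (α + 1) P ↔
      ∃ f : ℕ → P, StrictAnti f ∧ ∀ i, DeviationGE α (Set.Icc (f (i + 1)) (f i)) := by
  rw [deviationGE_iff]
  constructor
  · exact fun h => h.2 α (Order.lt_add_one_iff.2 le_rfl)
  · rintro ⟨f, hf, h⟩
    exact ⟨⟨f 1, f 0, hf Nat.zero_lt_one⟩, fun β hβ =>
      ⟨f, hf, fun i => (h i).mono (Order.lt_add_one_iff.1 hβ)⟩⟩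

/-- Deviation at least a limit ordinal: deviation at least each smaller ordinal. -/
theorem deviationGE_limit {l : Ordinal.{w}} (hl : Order.IsSuccLimit l) (P : Type u)
    [PartialOrder P] : DeviationGE l P ↔ ∀ α < l, DeviationGE α P := by
  constructor
  · exact fun h α hα => h.mono hα.le
  · intro h
    rw [deviationGE_iff]
    refine ⟨(deviationGE_zero P).1 (h 0 hl.bot_lt), fun β hβ => ?_⟩
    exact (deviationGE_succ β P).1 (h _ (by simpa using hl.succ_lt hβ))

open Classical in
/-- The deviation of a poset: `⊥` (that is, `-1`) if the poset is trivial, the ordinal `α` if the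
poset has deviation at least `α` but not at least `α + 1`, and `⊤` (that is, `∞`) if no such
ordinal exists. -/
noncomputable def deviation (P : Type u) [PartialOrder P] : WithBot (WithTop Ordinal.{u}) :=
  if ∃ a b : P, a < b then
    if h : ∃ α : Ordinal.{u}, DeviationGE α P ∧ ¬ DeviationGE (α + 1) P then
      ((h.choose : WithTop Ordinal.{u}) : WithBot (WithTop Ordinal.{u}))
    else ((⊤ : WithTop Ordinal.{u}) : WithBot (WithTop Ordinal.{u}))
  else ⊥

theorem deviation_eq_iff (P : Type u) [PartialOrder P] (α : Ordinal.{u}) :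
    deviation P = ((α : WithTop Ordinal.{u}) : WithBot (WithTop Ordinal.{u})) ↔
      DeviationGE α P ∧ ¬ DeviationGE (α + 1) P := by
  have uniq : ∀ β γ : Ordinal.{u}, DeviationGE β P → ¬ DeviationGE (γ + 1) P → β ≤ γ := by
    intro β γ hβ hγ
    by_contra hlt
    exact hγ (hβ.mono (Order.add_one_le_iff.2 (not_le.1 hlt)))
  unfold deviation
  split_ifs with h0 h
  · rw [WithBot.coe_inj, WithTop.coe_inj]
    constructor
    · rintro rfl
      exact h.choose_spec
    · intro hα
      exact le_antisymm (uniq _ _ h.choose_spec.1 hα.2) (uniq _ _ hα.1 h.choose_spec.2)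
  · rw [WithBot.coe_inj]
    exact ⟨fun e => absurd e WithTop.top_ne_coe, fun hα => absurd ⟨α, hα⟩ h⟩
  · refine ⟨fun e => absurd e WithBot.bot_ne_coe, fun hα => ?_⟩
    exact absurd ((deviationGE_iff α P).1 hα.1).1 h0

/-! ### Krull dimension, critical objects, critical composition series -/

section

variable {C : Type u} [Category.{v} C] [Abelian C]

/-- The Gabriel–Rentschler Krull dimension of an object: the deviation of its poset of
subobjects. -/
noncomputable def grKrullDim (A : C) : WithBot (WithTop Ordinal.{max u v}) :=
  deviation (Subobject A)

/-- A nonzero object `A` is `α`-critical if it has Krull dimension `α` and every quotient of `A` by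
a nonzero subobject has Krull dimension less than `α`. -/
def IsCriticalOfDim (α : Ordinal.{max u v}) (A : C) : Prop :=
  ¬ IsZero A ∧ grKrullDim A = ((α : WithTop Ordinal.{max u v}) : WithBot (WithTop _)) ∧
    ∀ B : Subobject A, B ≠ ⊥ →
      grKrullDim (cokernel B.arrow) < ((α : WithTop Ordinal.{max u v}) : WithBot (WithTop _))

/-- An object is critical if it is `α`-critical for some ordinal `α`. -/
def IsCriticalObject (A : C) : Prop :=
  ∃ α : Ordinal.{max u v}, IsCriticalOfDim α A

/-- The critical dimension of a (nonzero) object: the minimum of the Krull dimensions of its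
nonzero subobjects. The infimum is over a family in a well-ordered set, which is nonempty if `A`
is nonzero, and so is a minimum. -/
noncomputable def criticalDim (A : C) : WithBot (WithTop Ordinal.{max u v}) :=
  ⨅ B : {B : Subobject A // B ≠ ⊥}, grKrullDim (B.1 : C)

theorem criticalDim_le {A : C} (B : Subobject A) (hB : B ≠ ⊥) :
    criticalDim A ≤ grKrullDim (B : C) :=
  iInf_le (fun B : {B : Subobject A // B ≠ ⊥} => grKrullDim (B.1 : C)) ⟨B, hB⟩

/-- The minimum defining `criticalDim A` is attained as soon as `A` has a nonzero subobject. -/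
theorem exists_grKrullDim_eq_criticalDim {A : C} (B : Subobject A) (hB : B ≠ ⊥) :
    ∃ B' : Subobject A, B' ≠ ⊥ ∧ grKrullDim (B' : C) = criticalDim A := by
  have : Nonempty {B : Subobject A // B ≠ ⊥} := ⟨⟨B, hB⟩⟩
  obtain ⟨B', hB'⟩ := ciInf_mem (fun B : {B : Subobject A // B ≠ ⊥} => grKrullDim (B.1 : C))
  exact ⟨B'.1, B'.2, hB'⟩

/-- The `i`-th factor `A_{i+1} / A_i` of a finite chain `A_0 < A_1 < ... < A_n` of subobjects. -/
noncomputable def seriesFactor {A : C} (s : LTSeries (Subobject A)) (i : Fin s.length) : C :=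
  cokernel (Subobject.ofLE (s i.castSucc) (s i.succ) (s.step i).le)

/-- A critical composition series of `A`: a finite chain `0 = A_0 < A_1 < ... < A_n = A` of
subobjects whose factors `A_{i+1} / A_i` are critical, of non-decreasing Krull dimension. -/
structure IsCriticalCompositionSeries {A : C} (s : LTSeries (Subobject A)) : Prop where
  head_eq : s.head = ⊥
  last_eq : s.last = ⊤
  critical : ∀ i : Fin s.length, IsCriticalObject (seriesFactor s i)
  monotone_dim : Monotone fun i : Fin s.length => grKrullDim (seriesFactor s i)

/-! ### Injective hulls and the injective spectrum -/

/-- A morphism `f : A ⟶ E` is an essential monomorphism if it is a monomorphism and its image meets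
every nonzero subobject of `E` nontrivially. -/
def IsEssentialMono {A E : C} (f : A ⟶ E) : Prop :=
  ∃ _ : Mono f, ∀ B : Subobject E, B ≠ ⊥ → Subobject.mk f ⊓ B ≠ ⊥

/-- `E` is an injective hull of `A`: it is injective and an essential extension of `A`. -/
def IsInjectiveHull (A E : C) : Prop :=
  Injective E ∧ ∃ f : A ⟶ E, IsEssentialMono f

/-- `G` is a noetherian generator. A Grothendieck category is strongly locally noetherian via `G` if
this holds. -/
structure IsNoetherianGenerator (G : C) : Prop where
  isSeparator : IsSeparator G
  isNoetherianObject : IsNoetherianObject G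

variable (C) in
/-- The points of critical dimension `d` of the injective spectrum: the set of isomorphism classes of
indecomposable injective objects of critical dimension `d`. -/
def injSpecOfCriticalDim (d : Ordinal.{max u v}) : Set (Quotient (isIsomorphicSetoid C)) :=
  {x | ∃ E : C, Indecomposable E ∧ Injective E ∧
    criticalDim E = ((d : WithTop Ordinal.{max u v}) : WithBot (WithTop _)) ∧
    Quotient.mk _ E = x}

end

/-! ### Deviation: functoriality, products, noetherian posets -/

section

universe u₁ u₂

/-! For a ≤ b ≤ c in a modular lattice, the deviation of [a, c] is the larger of those of [a, b] and
[b, c] (`DeviationGE.Icc_or`). Hence in a critical object every nonzero subobject has the full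
dimension and any two nonzero subobjects meet (`IsCriticalInterval.deviationGE`,
`IsCriticalInterval.lt_inf`). An injective hull of an α-critical object is therefore indecomposable
of critical dimension α.

Conversely, let E be indecomposable injective with cd(E) = d. Since G is a generator, there is a
nonzero map G ⟶ E, and it induces a nonzero map from some factor F of the series. F is γ-critical
with γ ≤ d; a proper quotient of F has dimension below γ, too small for a nonzero subobject of E, so
F ⟶ E is monic (`IsCriticalOfDim.mono_of_ne_zero`). Thus E is a hull of F and γ = cd(E) = d.
Finiteness follows because hulls are unique up to isomorphism; nonemptiness because some factor
carries the whole deviation of G.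

The series is built greedily: each step adds a maximal critical subobject of least dimension in the
current quotient, and maximality keeps the dimensions from dropping
(`IsMaximalCriticalStep.deviationGE_of_lt`). -/

theorem DeviationGE.of_strictMono {α : Ordinal.{w}} {P : Type u₁} [PartialOrder P] {Q : Type u₂}
    [PartialOrder Q] {g : P → Q} (hg : StrictMono g) (h : DeviationGE α P) : DeviationGE α Q := by
  induction α using WellFoundedLT.induction generalizing P Q with
  | ind α ih =>
    rw [deviationGE_iff] at h ⊢
    obtain ⟨⟨a, b, hab⟩, h⟩ := h
    refine ⟨⟨g a, g b, hg hab⟩, fun β hβ => ?_⟩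
    obtain ⟨f, hf, hfβ⟩ := h β hβ
    refine ⟨g ∘ f, hg.comp_strictAnti hf, fun i => ?_⟩
    exact ih β hβ (g := fun x => ⟨g x.1, hg.monotone x.2.1, hg.monotone x.2.2⟩)
      (fun x y hxy => hg hxy) (hfβ i)

theorem deviationGE_congr {α : Ordinal.{w}} {P : Type u₁} [PartialOrder P] {Q : Type u₂}
    [PartialOrder Q] (e : P ≃o Q) : DeviationGE α P ↔ DeviationGE α Q :=
  ⟨.of_strictMono e.strictMono, .of_strictMono e.symm.strictMono⟩

theorem DeviationGE.exists_lt {α : Ordinal.{w}} {P : Type u₁} [PartialOrder P]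
    (h : DeviationGE α P) : ∃ a b : P, a < b :=
  ((deviationGE_iff α P).1 h).1

theorem DeviationGE.of_Icc_subset {α : Ordinal.{w}} {P : Type u₁} [PartialOrder P] {a b a' b' : P}
    (ha : a' ≤ a) (hb : b ≤ b') (h : DeviationGE α (Set.Icc a b)) :
    DeviationGE α (Set.Icc a' b') :=
  h.of_strictMono (g := fun x => ⟨x.1, ha.trans x.2.1, x.2.2.trans hb⟩) fun _ _ hxy => hxy

theorem DeviationGE.lt_of_Icc {α : Ordinal.{w}} {P : Type u₁} [PartialOrder P] {a b : P}
    (h : DeviationGE α (Set.Icc a b)) : a < b := by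
  obtain ⟨x, y, hxy⟩ := h.exists_lt
  exact (x.2.1.trans_lt hxy).trans_le y.2.2

/-- A sequence whose successive terms are comparable and infinitely often bound an interval of
deviation at least `α` witnesses deviation at least `α + 1`. -/
theorem DeviationGE.succ_of_frequently {α : Ordinal.{w}} {P : Type u₁} [PartialOrder P] {f : ℕ → P}
    (hf : Antitone f) (h : ∀ n, ∃ i ≥ n, DeviationGE α (Set.Icc (f (i + 1)) (f i))) :
    DeviationGE (α + 1) P := by
  rw [deviationGE_succ]
  obtain ⟨φ, hφ, hφα⟩ := Filter.extraction_of_frequently_atTop (Filter.frequently_atTop.2 h)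
  have key : ∀ i, DeviationGE α (Set.Icc (f (φ (i + 1))) (f (φ i))) := fun i =>
    (hφα i).of_Icc_subset (hf (hφ i.lt_succ_self)) le_rfl
  exact ⟨f ∘ φ, strictAnti_nat_of_succ_lt fun i => (key i).lt_of_Icc, key⟩

/-- Along a descending chain in the product, one of the two coordinates has a large drop infinitely
often, which settles the successor case. At a limit, failures at β and γ contradict the case of
their maximum. -/
theorem DeviationGE.of_prod {α : Ordinal.{w}} {P : Type u₁} [PartialOrder P] {Q : Type u₂}
    [PartialOrder Q] (h : DeviationGE α (P × Q)) : DeviationGE α P ∨ DeviationGE α Q := by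
  induction α using Ordinal.limitRecOn generalizing P Q with
  | zero =>
    obtain ⟨a, b, hab⟩ := h.exists_lt
    rw [deviationGE_zero, deviationGE_zero]
    rcases Prod.lt_iff.1 hab with h | h
    · exact .inl ⟨_, _, h.1⟩
    · exact .inr ⟨_, _, h.2⟩
  | add_one α ih =>
    obtain ⟨f, hf, hfα⟩ := (deviationGE_succ α _).1 h
    have hor : ∀ i, DeviationGE α (Set.Icc (f (i + 1)).1 (f i).1) ∨
        DeviationGE α (Set.Icc (f (i + 1)).2 (f i).2) := fun i =>
      ih ((hfα i).of_strictMono (g := fun x => (⟨x.1.1, x.2.1.1, x.2.2.1⟩, ⟨x.1.2, x.2.1.2, x.2.2.2⟩))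
        fun x y hxy => hxy)
    by_cases hP : ∀ n, ∃ i ≥ n, DeviationGE α (Set.Icc (f (i + 1)).1 (f i).1)
    · exact .inl (.succ_of_frequently (f := fun i => (f i).1) (fun i j hij => (hf.antitone hij).1) hP)
    · push Not at hP
      obtain ⟨n, hn⟩ := hP
      exact .inr (.succ_of_frequently (f := fun i => (f i).2) (fun i j hij => (hf.antitone hij).2)
        fun m => ⟨max n m, le_max_right _ _, (hor _).resolve_left (hn _ (le_max_left _ _))⟩)
  | limit l hl ih =>
    by_contra hcon
    rw [deviationGE_limit hl, deviationGE_limit hl] at hcon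
    push Not at hcon
    obtain ⟨⟨β, hβ, hβP⟩, γ, hγ, hγQ⟩ := hcon
    rcases ih (max β γ) (max_lt hβ hγ) (h.mono (max_lt hβ hγ).le) with h | h
    · exact hβP (h.mono (le_max_left _ _))
    · exact hγQ (h.mono (le_max_right _ _))

theorem exists_not_deviationGE_Ici {P : Type u₁} [PartialOrder P] [WellFoundedGT P] (a : P) :
    ∃ σ : Ordinal.{u₁}, ¬ DeviationGE σ (Set.Ici a) := by
  induction a using WellFoundedGT.induction with
  | ind a ih =>
    choose σ hσ using ih
    let τ : Ordinal.{u₁} := ⨆ b : Set.Ioi a, σ b.1 b.2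
    refine ⟨τ + 1, fun h => ?_⟩
    obtain ⟨f, hf, hfτ⟩ := (deviationGE_succ _ _).1 h
    -- Since a ≤ f 2 < f 1, the whole first factor [f 1, f 0] lies above a point strictly greater
    -- than a, where the induction hypothesis applies.
    have h1 : a < (f 1).1 := lt_of_le_of_lt (f 2).2 (hf one_lt_two)
    refine hσ _ h1 (DeviationGE.mono (Ordinal.le_iSup (fun b : Set.Ioi a => σ b.1 b.2) ⟨_, h1⟩) ?_)
    exact (hfτ 0).of_strictMono (g := fun x => ⟨x.1.1, x.2.1⟩) fun x y hxy => hxy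

theorem exists_not_deviationGE (P : Type u₁) [PartialOrder P] [OrderBot P] [WellFoundedGT P] :
    ∃ σ : Ordinal.{u₁}, ¬ DeviationGE σ P := by
  obtain ⟨σ, hσ⟩ := exists_not_deviationGE_Ici (⊥ : P)
  exact ⟨σ, fun h => hσ (h.of_strictMono (g := fun x => ⟨x, bot_le⟩) fun x y hxy => hxy)⟩

/-- The least ordinal that fails is neither zero nor a limit, so it is d + 1 for the wanted d. -/
theorem exists_deviationGE_not_succ {P : Type u₁} [PartialOrder P] (h0 : ∃ a b : P, a < b)
    (h : ∃ σ : Ordinal.{w}, ¬ DeviationGE σ P) :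
    ∃ d : Ordinal.{w}, DeviationGE d P ∧ ¬ DeviationGE (d + 1) P := by
  obtain ⟨σ, hσ, hmin⟩ := WellFounded.has_min (wellFounded_lt (α := Ordinal.{w}))
    {σ : Ordinal.{w} | ¬ DeviationGE σ P} h
  have hlt : ∀ β < σ, DeviationGE β P := fun β hβ => by_contra fun hn => hmin β hn hβ
  rcases Ordinal.zero_or_succ_or_isSuccLimit σ with rfl | ⟨d, rfl⟩ | hl
  · exact absurd ((deviationGE_zero P).2 h0) hσ
  · exact ⟨d, hlt d (Order.lt_succ d), hσ⟩
  · exact absurd ((deviationGE_limit hl P).2 hlt) hσ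

theorem coe_le_deviation_iff {P : Type u₁} [PartialOrder P] {α : Ordinal.{u₁}} :
    ((α : WithTop Ordinal.{u₁}) : WithBot (WithTop Ordinal.{u₁})) ≤ deviation P ↔
      DeviationGE α P := by
  by_cases h0 : ∃ a b : P, a < b
  · by_cases h : ∃ σ : Ordinal.{u₁}, ¬ DeviationGE σ P
    · obtain ⟨d, hd, hd'⟩ := exists_deviationGE_not_succ h0 h
      rw [(deviation_eq_iff P d).2 ⟨hd, hd'⟩, WithBot.coe_le_coe, WithTop.coe_le_coe]
      refine ⟨fun hα => hd.mono hα, fun hα => ?_⟩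
      by_contra hlt
      exact hd' (hα.mono (Order.add_one_le_iff.2 (not_le.1 hlt)))
    · push Not at h
      have : deviation P = ((⊤ : WithTop Ordinal.{u₁}) : WithBot (WithTop Ordinal.{u₁})) := by
        rw [deviation, if_pos h0, dif_neg]
        rintro ⟨α, -, hα⟩
        exact hα (h _)
      simp [this, h α]
  · have : deviation P = ⊥ := by rw [deviation, if_neg h0]
    rw [this]
    exact ⟨fun h => absurd h (by simp), fun h => absurd h.exists_lt h0⟩

theorem deviation_lt_coe_iff {P : Type u₁} [PartialOrder P] {α : Ordinal.{u₁}} :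
    deviation P < ((α : WithTop Ordinal.{u₁}) : WithBot (WithTop Ordinal.{u₁})) ↔
      ¬ DeviationGE α P := by
  rw [← coe_le_deviation_iff, not_le]

/-! ### Critical intervals in modular lattices -/

/-- The interval `[a, b]` is `α`-critical: it has deviation at least `α`, but `[x, b]` has smaller
deviation for every `x` with `a < x ≤ b`. -/
def IsCriticalInterval (α : Ordinal.{w}) {P : Type u₁} [PartialOrder P] (a b : P) : Prop :=
  DeviationGE α (Set.Icc a b) ∧ ∀ x, a < x → x ≤ b → ¬ DeviationGE α (Set.Icc x b)

theorem IsCriticalInterval.not_succ {α : Ordinal.{w}} {P : Type u₁} [PartialOrder P] {a b : P}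
    (h : IsCriticalInterval α a b) : ¬ DeviationGE (α + 1) (Set.Icc a b) := by
  intro hs
  obtain ⟨f, hf, hfα⟩ := (deviationGE_succ _ _).1 hs
  have h1 : a < (f 1).1 := lt_of_le_of_lt (f 2).2.1 (hf one_lt_two)
  refine h.2 _ h1 (f 1).2.2 ?_
  exact (hfα 0).of_strictMono (g := fun x => ⟨x.1.1, x.2.1, x.1.2.2⟩) fun x y hxy => hxy

theorem IsCriticalInterval.deviation_eq {P : Type u₁} [PartialOrder P] {α : Ordinal.{u₁}} {a b : P}
    (h : IsCriticalInterval α a b) : deviation (Set.Icc a b) =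
      ((α : WithTop Ordinal.{u₁}) : WithBot (WithTop Ordinal.{u₁})) :=
  (deviation_eq_iff _ α).2 ⟨h.1, h.not_succ⟩

theorem exists_not_deviationGE_Icc {P : Type u₁} [PartialOrder P] [OrderBot P]
    [WellFoundedGT P] (a b : P) : ∃ σ : Ordinal.{u₁}, ¬ DeviationGE σ (Set.Icc a b) := by
  obtain ⟨σ, hσ⟩ := exists_not_deviationGE P
  exact ⟨σ, fun h => hσ (h.of_strictMono (g := Subtype.val) fun x y hxy => hxy)⟩

/-- If no [a, c] were critical, each c could be replaced by some y with a < y < c and [y, c] of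
deviation at least α; iterating from b would give [a, b] deviation α + 1. -/
theorem exists_isCriticalInterval_le {P : Type u₁} [PartialOrder P] {α : Ordinal.{w}} {a b : P} (hab : a < b)
    (hα : ∀ x, a < x → x ≤ b → DeviationGE α (Set.Icc a x))
    (hb : ¬ DeviationGE (α + 1) (Set.Icc a b)) :
    ∃ c, c ≤ b ∧ IsCriticalInterval α a c := by
  by_contra! hcon
  have step : ∀ x : Set.Ioc a b, ∃ y : Set.Ioc a b, y.1 ≤ x.1 ∧ DeviationGE α (Set.Icc y.1 x.1) := by
    intro x
    have := hcon x.1 x.2.2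
    simp only [IsCriticalInterval, not_and, not_forall, not_not] at this
    obtain ⟨y, hay, hyx, hy⟩ := this (hα x.1 x.2.1 x.2.2)
    exact ⟨⟨y, hay, hyx.trans x.2.2⟩, hyx, hy⟩
  choose g hg hgα using step
  let f : ℕ → Set.Ioc a b := fun n => g^[n] ⟨b, hab, le_rfl⟩
  have hf : ∀ n, f (n + 1) = g (f n) := fun n => Function.iterate_succ_apply' g n _
  refine hb ((deviationGE_succ _ _).2 ⟨fun n => ⟨(f n).1, (f n).2.1.le, (f n).2.2⟩,
    strictAnti_nat_of_succ_lt fun n => ?_, fun n => ?_⟩)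
  · change (f (n + 1)).1 < (f n).1
    rw [hf]
    exact (hgα (f n)).lt_of_Icc
  · refine (show DeviationGE α (Set.Icc (f (n + 1)).1 (f n).1) by rw [hf]; exact hgα _).of_strictMono
      (g := fun x => ⟨⟨x.1, (f (n + 1)).2.1.le.trans x.2.1, x.2.2.trans (f n).2.2⟩, x.2⟩) ?_
    exact fun x y hxy => hxy

/-- `b` is a maximal element such that `[a, b]` is critical of the minimal possible deviation
`α`. -/
structure IsMaximalCriticalStep {L : Type u₁} [PartialOrder L] (α : Ordinal.{w})
    (a b : L) : Prop where
  isCriticalInterval : IsCriticalInterval α a b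
  deviationGE : ∀ x, a < x → DeviationGE α (Set.Icc a x)
  maximal : ∀ c, b < c → ¬ IsCriticalInterval α a c

/-- Here α is the least deviation of an interval [a, x] with a < x; the ascending chain condition
then provides a maximal critical one. -/
theorem exists_isMaximalCriticalStep {L : Type u₁} [PartialOrder L] [BoundedOrder L]
    [WellFoundedGT L] {a : L} (ha : a < ⊤) :
    ∃ (b : L) (α : Ordinal.{u₁}), IsMaximalCriticalStep α a b := by
  have hdev : ∀ x, a < x → ∃ γ : Ordinal.{u₁},
      DeviationGE γ (Set.Icc a x) ∧ ¬ DeviationGE (γ + 1) (Set.Icc a x) := fun x hx =>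
    exists_deviationGE_not_succ ⟨⟨a, le_rfl, hx.le⟩, ⟨x, hx.le, le_rfl⟩, hx⟩
      (exists_not_deviationGE_Icc a x)
  obtain ⟨α, ⟨b, hab, hb⟩, hmin⟩ := WellFounded.has_min (wellFounded_lt (α := Ordinal.{u₁}))
    {γ : Ordinal.{u₁} | ∃ b, a < b ∧ ¬ DeviationGE (γ + 1) (Set.Icc a b)}
    (by obtain ⟨γ, -, hγ⟩ := hdev ⊤ ha; exact ⟨γ, ⊤, ha, hγ⟩)
  have hα : ∀ x, a < x → DeviationGE α (Set.Icc a x) := fun x hx => by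
    obtain ⟨γ, hγ, hγ'⟩ := hdev x hx
    exact hγ.mono (not_lt.1 (hmin γ ⟨x, hx, hγ'⟩))
  obtain ⟨c, -, hc⟩ := exists_isCriticalInterval_le hab (fun x hx _ => hα x hx) hb
  obtain ⟨m, hm, hmax⟩ := WellFounded.has_min (wellFounded_gt (α := L))
    {m | IsCriticalInterval α a m} ⟨c, hc⟩
  exact ⟨m, α, hm, hα, fun c hc h => hmax c h hc⟩

section Lattice

variable {L : Type u₁} [Lattice L] [IsModularLattice L] {α : Ordinal.{w}}

/-- Modularity makes x ↦ (x ⊓ b, x ⊔ b) strictly monotone, which reduces the claim to products. -/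
theorem DeviationGE.Icc_or {a b c : L} (hab : a ≤ b) (hbc : b ≤ c)
    (h : DeviationGE α (Set.Icc a c)) :
    DeviationGE α (Set.Icc a b) ∨ DeviationGE α (Set.Icc b c) := by
  refine (h.of_strictMono (g := fun x => ((⟨x.1 ⊓ b, le_inf x.2.1 hab, inf_le_right⟩ : Set.Icc a b),
    (⟨x.1 ⊔ b, le_sup_right, sup_le x.2.2 hbc⟩ : Set.Icc b c))) ?_).of_prod
  intro x y hxy
  exact strictMono_inf_prod_sup (z := b) (show x.1 < y.1 from hxy)

theorem deviationGE_Icc_inf_iff {a b : L} :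
    DeviationGE α (Set.Icc (a ⊓ b) a) ↔ DeviationGE α (Set.Icc b (a ⊔ b)) :=
  deviationGE_congr (infIccOrderIsoIccSup a b)

theorem IsCriticalInterval.deviationGE {a b x : L} (h : IsCriticalInterval α a b) (hx : a < x)
    (hxb : x ≤ b) : DeviationGE α (Set.Icc a x) :=
  (h.1.Icc_or hx.le hxb).resolve_right (h.2 x hx hxb)

/-- Critical intervals are uniform: if x ⊓ y = a, then [a, x] ≅ [y, x ⊔ y] sits inside [y, b], whose
deviation is too small. -/
theorem IsCriticalInterval.lt_inf {a b x y : L} (h : IsCriticalInterval α a b) (hx : a < x)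
    (hxb : x ≤ b) (hy : a < y) (hyb : y ≤ b) : a < x ⊓ y := by
  refine lt_of_le_of_ne (le_inf hx.le hy.le) fun e => h.2 y hy hyb ?_
  have := h.deviationGE hx hxb
  rw [e, deviationGE_Icc_inf_iff] at this
  exact this.of_Icc_subset le_rfl (sup_le hxb hyb)

/-- If [b, y] were smaller than α, then [a, y] would be critical, against maximality of b. For a < x
≤ y the two cases are a < x ⊓ b and a = x ⊓ b; the diamond isomorphism moves the relevant interval
into [a, b] or [b, y]. -/
theorem IsMaximalCriticalStep.deviationGE_of_lt {a b : L}
    (h : IsMaximalCriticalStep α a b) {y : L} (hy : b < y) : DeviationGE α (Set.Icc b y) := by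
  by_contra hn
  have hab := h.isCriticalInterval.1.lt_of_Icc
  refine h.maximal y hy ⟨h.deviationGE y (hab.trans hy), fun x hax hxy hx => ?_⟩
  rcases (inf_le_inf_right b hax.le).lt_or_eq with hlt | heq
  · rw [inf_eq_left.2 hab.le] at hlt
    rcases hx.Icc_or (le_sup_left : x ≤ x ⊔ b) (sup_le hxy hy.le) with h' | h'
    · rw [sup_comm, ← deviationGE_Icc_inf_iff, inf_comm] at h'
      exact h.isCriticalInterval.2 _ hlt inf_le_right h'
    · exact hn (h'.of_Icc_subset le_sup_right le_rfl)
  · rw [inf_eq_left.2 hab.le] at heq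
    have h' := h.deviationGE x hax
    rw [heq, deviationGE_Icc_inf_iff] at h'
    exact hn (h'.of_Icc_subset le_rfl (sup_le hxy hy.le))

end Lattice

/-! ### Critical series in noetherian modular lattices -/

section Noetherian

variable {L : Type u₁} [Lattice L] [BoundedOrder L] [IsModularLattice L] [WellFoundedGT L]

variable (L) in
theorem exists_critical_series : ∃ (s : LTSeries L) (α : Fin s.length → Ordinal.{u₁}),
    s.head = ⊥ ∧ s.last = ⊤ ∧
      (∀ i : Fin s.length, IsCriticalInterval (α i) (s i.castSucc) (s i.succ)) ∧ Monotone α := by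
  have hex : ∀ a : L, ∃ (b : L) (α : Ordinal.{u₁}), a < ⊤ → IsMaximalCriticalStep α a b := by
    intro a
    by_cases ha : a < ⊤
    · obtain ⟨b, α, h⟩ := exists_isMaximalCriticalStep ha
      exact ⟨b, α, fun _ => h⟩
    · exact ⟨⊥, 0, fun h => absurd h ha⟩
  choose next dim hnext using hex
  let f : ℕ → L := fun n => next^[n] ⊥
  have hf : ∀ n, f (n + 1) = next (f n) := fun n => Function.iterate_succ_apply' next n _
  have hstep : ∀ n, f n < ⊤ → IsMaximalCriticalStep (dim (f n)) (f n) (f (n + 1)) := fun n hn => by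
    rw [hf]; exact hnext _ hn
  have htop : ∃ n, f n = ⊤ := by
    by_contra! hcon
    exact not_strictMono_of_wellFoundedGT f (strictMono_nat_of_lt_succ fun n =>
      (hstep n (hcon n).lt_top).isCriticalInterval.1.lt_of_Icc)
  classical
  have hlt : ∀ n < Nat.find htop, f n < ⊤ := fun n hn => (Ne.lt_top (Nat.find_min htop hn))
  have hmono : ∀ i j, i ≤ j → j < Nat.find htop → dim (f i) ≤ dim (f j) := by
    intro i j hij
    induction j, hij using Nat.le_induction with
    | base => exact fun _ => le_rfl
    | succ j hij ih =>
      intro hj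
      refine (ih (j.lt_succ_self.trans hj)).trans ?_
      have h1 := hstep j (hlt j (j.lt_succ_self.trans hj))
      have h2 := (hstep (j + 1) (hlt _ hj)).isCriticalInterval
      by_contra hcon
      exact h2.not_succ ((h1.deviationGE_of_lt h2.1.lt_of_Icc).mono
        (Order.add_one_le_iff.2 (not_le.1 hcon)))
  refine ⟨⟨Nat.find htop, fun i => f i, fun i => ?_⟩, fun i => dim (f i), rfl, Nat.find_spec htop,
    fun i => (hstep i (hlt i i.2)).isCriticalInterval, fun i j hij => hmono i j hij j.2⟩
  exact (hstep i (hlt i i.2)).isCriticalInterval.1.lt_of_Icc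

end Noetherian

end

/-! ### Subobjects in abelian categories -/

section

variable {C : Type u} [Category.{v} C] [Abelian C]

namespace CategoryTheory.Subobject

/-- Epimorphisms are strong here, so factoring through a subobject may be tested after a refinement;
this permits element-style arguments. -/
theorem factors_of_epi_comp {X : C} {S : Subobject X} {T T' : C} (π : T' ⟶ T) [Epi π] {h : T ⟶ X}
    (H : S.Factors (π ≫ h)) : S.Factors h := by
  have sq : CommSq (S.factorThru _ H) π S.arrow h := ⟨by simp⟩
  have := strongEpi_of_epi π
  rw [← sq.fac_right]
  exact factors_comp_arrow _

theorem exists_eq_add_of_sup_factors {X : C} {S T : Subobject X} {A : C} {h : A ⟶ X}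
    (H : (S ⊔ T).Factors h) : ∃ (A' : C) (π : A' ⟶ A) (_ : Epi π) (a b : A' ⟶ X),
      S.Factors a ∧ T.Factors b ∧ π ≫ h = a + b := by
  let g : (S : C) ⊞ (T : C) ⟶ X := biprod.desc S.arrow T.arrow
  have hS : S ≤ imageSubobject g :=
    le_of_comm (biprod.inl ≫ factorThruImageSubobject g) (by simp [g])
  have hT : T ≤ imageSubobject g :=
    le_of_comm (biprod.inr ≫ factorThruImageSubobject g) (by simp [g])
  have H' := factors_of_le h (sup_le hS hT) H
  obtain ⟨A', π, hπ, x, hx⟩ := surjective_up_to_refinements_of_epi (factorThruImageSubobject g)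
    (factorThru _ h H')
  refine ⟨A', π, hπ, (x ≫ biprod.fst) ≫ S.arrow, (x ≫ biprod.snd) ≫ T.arrow,
    factors_comp_arrow _, factors_comp_arrow _, ?_⟩
  have := congrArg (· ≫ (imageSubobject g).arrow) hx
  simp only [Category.assoc, factorThru_arrow, imageSubobject_arrow_comp] at this
  rw [this, Category.assoc, Category.assoc, ← Preadditive.comp_add]
  congr 1
  ext <;> simp [g]

instance (X : C) : IsModularLattice (Subobject X) where
  sup_inf_le_assoc_of_le {S} T {U} hSU := by
    apply le_of_factors
    have hf := factors_self ((S ⊔ T) ⊓ U)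
    obtain ⟨A, π, hπ, a, b, ha, hb, hab⟩ :=
      exists_eq_add_of_sup_factors (factors_left_of_inf_factors hf)
    -- The modular law on elements: a + b lies in U and a in S ≤ U, hence b lies in U.
    have hbU : U.Factors b := by
      have h1 : U.Factors (a + b) := by
        rw [← hab]
        exact factors_of_factors_right _ (factors_right_of_inf_factors hf)
      exact factors_right_of_factors_add _ _ h1 (factors_of_le _ hSU ha)
    apply factors_of_epi_comp π
    rw [hab]
    exact factors_add _ _ (sup_factors_of_factors_left ha)
      (sup_factors_of_factors_right ((inf_factors _).2 ⟨hb, hbU⟩))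

theorem pullback_le_pullback_iff {X Q : C} (e : X ⟶ Q) [Epi e] {S T : Subobject Q} :
    (pullback e).obj S ≤ (pullback e).obj T ↔ S ≤ T := by
  refine ⟨fun h => ?_, fun h => (pullback e).monotone h⟩
  apply le_of_factors
  obtain ⟨A, π, hπ, x, hx⟩ := surjective_up_to_refinements_of_epi e S.arrow
  apply factors_of_epi_comp π
  rw [hx, ← pullback_factors_iff]
  refine factors_of_le _ h ?_
  rw [pullback_factors_iff, ← hx]
  exact factors_comp_arrow _

theorem kernelSubobject_le_pullback {X Q : C} (e : X ⟶ Q) (S : Subobject Q) :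
    kernelSubobject e ≤ (pullback e).obj S := by
  apply le_of_factors
  rw [pullback_factors_iff, kernelSubobject_arrow_comp]
  exact factors_zero

theorem pullback_imageSubobject {X Q : C} (e : X ⟶ Q) {S : Subobject X}
    (hS : kernelSubobject e ≤ S) : (pullback e).obj (imageSubobject (S.arrow ≫ e)) = S := by
  apply le_antisymm
  · apply le_of_factors
    have hf := (pullback_factors_iff e _ _).1
      (factors_self ((pullback e).obj (imageSubobject (S.arrow ≫ e))))
    set h := ((pullback e).obj (imageSubobject (S.arrow ≫ e))).arrow
    obtain ⟨A, π, hπ, x, hx⟩ := surjective_up_to_refinements_of_epi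
      (factorThruImageSubobject (S.arrow ≫ e)) (factorThru _ _ hf)
    have hx' := congrArg (· ≫ (imageSubobject (S.arrow ≫ e)).arrow) hx
    simp only [Category.assoc, factorThru_arrow, imageSubobject_arrow_comp] at hx'
    apply factors_of_epi_comp π
    -- The difference is killed by e, so it lies in the kernel, which S contains.
    have h1 : S.Factors (π ≫ h - x ≫ S.arrow) := by
      refine factors_of_le _ hS ((kernelSubobject_factors_iff _ _).2 ?_)
      simp [hx']
    have := factors_add _ _ h1 (factors_comp_arrow x)
    rwa [sub_add_cancel] at this
  · apply le_of_factors
    rw [pullback_factors_iff]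
    exact (factors_iff _ _).2 ⟨factorThruImageSubobject _,
      imageSubobject_arrow_comp (S.arrow ≫ e)⟩

/-- Subobjects of a quotient correspond to the subobjects containing the kernel. -/
noncomputable def orderIsoIciKernel {X Q : C} (e : X ⟶ Q) [Epi e] :
    Subobject Q ≃o Set.Ici (kernelSubobject e) where
  toFun S := ⟨(pullback e).obj S, kernelSubobject_le_pullback e S⟩
  invFun S := imageSubobject (S.1.arrow ≫ e)
  left_inv S := by
    apply le_antisymm <;>
    · rw [← pullback_le_pullback_iff e,
        pullback_imageSubobject e (kernelSubobject_le_pullback e S)]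
  right_inv S := Subtype.ext (pullback_imageSubobject e S.2)
  map_rel_iff' := pullback_le_pullback_iff e

theorem kernelSubobject_cokernel_π {X Y : C} (f : X ⟶ Y) [Mono f] :
    kernelSubobject (cokernel.π f) = mk f := by
  apply le_antisymm
  · exact le_mk_of_comm (Abelian.monoLift f _ (kernelSubobject_arrow_comp (cokernel.π f)))
      (Abelian.monoLift_comp _ _ _)
  · apply le_of_factors
    rw [kernelSubobject_factors_iff, ← underlyingIso_hom_comp_eq_mk, Category.assoc,
      cokernel.condition, comp_zero]

/-- Subobjects of a quotient `S' / S` correspond to the interval `[S, S']`. -/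
noncomputable def orderIsoIccCokernel {X : C} {S S' : Subobject X} (h : S ≤ S') :
    Subobject (cokernel (ofLE S S' h)) ≃o Set.Icc S S' :=
  have key : subobjectOrderIso S' (kernelSubobject (cokernel.π (ofLE S S' h))) = ⟨S, h⟩ := by
    rw [kernelSubobject_cokernel_π]
    exact (subobjectOrderIso S').apply_symm_apply ⟨S, h⟩
  (orderIsoIciKernel (cokernel.π (ofLE S S' h))).trans
    { toFun T := ⟨(subobjectOrderIso S' T.1).1,
        (congrArg Subtype.val key).symm.le.trans ((subobjectOrderIso S').monotone T.2),
        (subobjectOrderIso S' T.1).2⟩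
      invFun T := ⟨(subobjectOrderIso S').symm ⟨T.1, T.2.2⟩, by
        rw [Set.mem_Ici, OrderIso.le_symm_apply, key]
        exact T.2.1⟩
      left_inv T := Subtype.ext ((subobjectOrderIso S').symm_apply_apply T.1)
      right_inv T := Subtype.ext <| by
        change (subobjectOrderIso S' ((subobjectOrderIso S').symm ⟨T.1, T.2.2⟩)).1 = T.1
        rw [OrderIso.apply_symm_apply]
      map_rel_iff' {T U} := (subobjectOrderIso S').le_iff_le }

theorem isZero_iff_subsingleton {X : C} : IsZero X ↔ Subsingleton (Subobject X) := by
  refine ⟨fun h => subsingleton_of_isZero h, fun h => ?_⟩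
  by_contra hX
  exact not_subsingleton_iff_nontrivial.2 (nontrivial_of_not_isZero hX) h

/-- Subobjects of `A` correspond to the subobjects of `X` contained in `A`. -/
noncomputable def orderIsoIccMk {A X : C} (f : A ⟶ X) [Mono f] :
    Subobject A ≃o Set.Icc (⊥ : Subobject X) (mk f) :=
  ((mapIsoToOrderIso (underlyingIso f).symm).trans (subobjectOrderIso (mk f))).trans
    { toFun T := ⟨T.1, bot_le, T.2⟩
      invFun T := ⟨T.1, T.2.2⟩
      left_inv _ := rfl
      right_inv _ := rfl
      map_rel_iff' := Iff.rfl }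

end CategoryTheory.Subobject

/-! ### Critical objects as critical intervals of subobjects -/

open Subobject

theorem isCriticalOfDim_iff {A : C} {α : Ordinal.{max u v}} :
    IsCriticalOfDim α A ↔ IsCriticalInterval α (⊥ : Subobject A) ⊤ := by
  have hA : DeviationGE α (Subobject A) ↔ DeviationGE α (Set.Icc (⊥ : Subobject A) ⊤) :=
    ⟨.of_strictMono (g := fun x => ⟨x, bot_le, le_top⟩) fun _ _ h => h,
      .of_strictMono (g := Subtype.val) fun _ _ h => h⟩
  have hB : ∀ B : Subobject A, DeviationGE α (Subobject (cokernel B.arrow)) ↔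
      DeviationGE α (Set.Icc B ⊤) := fun B => by
    rw [deviationGE_congr (orderIsoIciKernel (cokernel.π B.arrow)), kernelSubobject_cokernel_π,
      mk_arrow]
    exact ⟨.of_strictMono (g := fun x => ⟨x.1, x.2, le_top⟩) fun _ _ h => h,
      .of_strictMono (g := fun x => ⟨x.1, x.2.1⟩) fun _ _ h => h⟩
  constructor
  · rintro ⟨-, h, h'⟩
    refine ⟨hA.1 ((deviation_eq_iff _ _).1 h).1, fun x hx _ hdev => ?_⟩
    exact deviation_lt_coe_iff.1 (h' x hx.ne') ((hB x).2 hdev)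
  · intro h
    refine ⟨fun hz => ?_, (deviation_eq_iff _ _).2 ⟨hA.2 h.1, fun hs => h.not_succ ?_⟩,
      fun B hB' => deviation_lt_coe_iff.2 fun hdev => ?_⟩
    · have := isZero_iff_subsingleton.1 hz
      obtain ⟨a, b, hab⟩ := (hA.2 h.1).exists_lt
      exact hab.ne (Subsingleton.elim _ _)
    · exact hs.of_strictMono (g := fun x => ⟨x, bot_le, le_top⟩) fun _ _ h => h
    · exact h.2 B (bot_lt_iff_ne_bot.2 hB') le_top ((hB B).1 hdev)

theorem IsCriticalInterval.map_orderIso {P Q : Type*} [PartialOrder P] [BoundedOrder P]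
    [PartialOrder Q] {a b : Q} (hab : a ≤ b) (e : P ≃o Set.Icc a b) {α : Ordinal.{w}} :
    IsCriticalInterval α (⊥ : P) ⊤ ↔ IsCriticalInterval α a b := by
  have hbot : ∀ y : Set.Icc a b, y.1 ≤ a → e.symm y = ⊥ := fun y hy => by
    rw [eq_bot_iff, OrderIso.symm_apply_le]
    exact hy.trans (e ⊥).2.1
  have key : ∀ x : P, DeviationGE α (Set.Icc x ⊤) ↔ DeviationGE α (Set.Icc (e x).1 b) := fun x =>
    ⟨.of_strictMono (g := fun y => ⟨(e y.1).1, e.monotone y.2.1, (e y.1).2.2⟩)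
      fun _ _ h => e.strictMono h,
    .of_strictMono (g := fun y => ⟨e.symm ⟨y.1, (e x).2.1.trans y.2.1, y.2.2⟩,
      (OrderIso.le_symm_apply _).2 y.2.1, le_top⟩) fun _ _ h => e.symm.strictMono h⟩
  have he : (e ⊥).1 = a := by
    have := hbot ⟨a, le_rfl, hab⟩ le_rfl
    rw [← this, e.apply_symm_apply]
  unfold IsCriticalInterval
  rw [key, he]
  refine and_congr_right fun _ => ⟨fun h x hax hxb hx => ?_, fun h x hx _ hdev => ?_⟩
  · refine h (e.symm ⟨x, hax.le, hxb⟩) (bot_lt_iff_ne_bot.2 fun h0 => ?_) le_top ((key _).2 ?_)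
    · rw [OrderIso.symm_apply_eq] at h0
      exact hax.ne' ((congrArg Subtype.val h0).trans he)
    · rwa [e.apply_symm_apply]
  · refine h _ ?_ (e x).2.2 ((key _).1 hdev)
    exact lt_of_eq_of_lt he.symm (e.strictMono hx)

theorem isCriticalOfDim_seriesFactor_iff {A : C} {s : LTSeries (Subobject A)} {i : Fin s.length}
    {α : Ordinal.{max u v}} : IsCriticalOfDim α (seriesFactor s i) ↔
      IsCriticalInterval α (s i.castSucc) (s i.succ) :=
  isCriticalOfDim_iff.trans
    (IsCriticalInterval.map_orderIso (s.step i).le (orderIsoIccCokernel (s.step i).le))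

theorem isCriticalOfDim_iff_mk {A X : C} (f : A ⟶ X) [Mono f] {α : Ordinal.{max u v}} :
    IsCriticalOfDim α A ↔ IsCriticalInterval α ⊥ (Subobject.mk f) :=
  isCriticalOfDim_iff.trans (IsCriticalInterval.map_orderIso bot_le (orderIsoIccMk f))

theorem coe_le_grKrullDim_iff {A X : C} (f : A ⟶ X) [Mono f] {α : Ordinal.{max u v}} :
    ((α : WithTop Ordinal.{max u v}) : WithBot (WithTop Ordinal.{max u v})) ≤ grKrullDim A ↔
      DeviationGE α (Set.Icc ⊥ (Subobject.mk f)) :=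
  coe_le_deviation_iff.trans (deviationGE_congr (orderIsoIccMk f))

end

/-! ### Essential monomorphisms and injective hulls -/

section

theorem injective_of_retract {C : Type u} [Category.{v} C] {E I : C} [Injective I] (s : E ⟶ I)
    (r : I ⟶ E) (h : s ≫ r = 𝟙 E) : Injective E where
  factors {X Y} g f _ := ⟨Injective.factorThru (g ≫ s) f ≫ r, by simp [h]⟩

variable {C : Type u} [Category.{v} C] [Abelian C]

/-- Both sides say that X and Y meet trivially inside Z. -/
theorem mono_comp_cokernel_π_iff {X Y Z : C} (i : X ⟶ Z) [Mono i] (j : Y ⟶ Z) [Mono j] :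
    Mono (j ≫ cokernel.π i) ↔ ∀ ⦃T : C⦄ (s : T ⟶ X) (t : T ⟶ Y), t ≫ j = s ≫ i → t = 0 := by
  constructor
  · intro h T s t hst
    rw [← cancel_mono (j ≫ cokernel.π i), reassoc_of% hst, cokernel.condition]
    simp
  · intro h
    refine Preadditive.mono_of_cancel_zero _ fun {T} t ht => ?_
    rw [← Category.assoc] at ht
    exact h (Abelian.monoLift i _ ht) t (Abelian.monoLift_comp _ _ _).symm

/-- Nonzero subobjects of E and non-monic maps out of E are exchanged through kernels and cokernels.
-/
theorem isEssentialMono_iff {A E : C} (f : A ⟶ E) :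
    IsEssentialMono f ↔ Mono f ∧ ∀ ⦃Z : C⦄ (g : E ⟶ Z), Mono (f ≫ g) → Mono g := by
  constructor
  · rintro ⟨hf, h⟩
    refine ⟨hf, fun Z g hg => ?_⟩
    by_contra hn
    have hK : kernelSubobject g ≠ ⊥ := fun h0 => hn <|
      Preadditive.mono_of_cancel_zero _ fun {T} t ht => by
        have := (kernelSubobject_factors_iff g t).2 ht
        rwa [h0, Subobject.bot_factors_iff_zero] at this
    refine h _ hK ?_
    have h1 := (Subobject.inf_arrow_factors_left (Subobject.mk f) (kernelSubobject g))
    have h2 := (kernelSubobject_factors_iff g _).1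
      (Subobject.inf_arrow_factors_right (Subobject.mk f) (kernelSubobject g))
    obtain ⟨t, ht⟩ := (Subobject.mk_factors_iff f _).1 h1
    change _ ⟶ A at t
    replace ht : t ≫ f = (Subobject.mk f ⊓ kernelSubobject g).arrow := ht
    have h0 : t = 0 := by
      rw [← cancel_mono (f ≫ g), ← Category.assoc, ht, h2, zero_comp]
    rw [← Subobject.mk_arrow (Subobject.mk f ⊓ kernelSubobject g), Subobject.mk_eq_bot_iff_zero,
      ← ht, h0, zero_comp]
  · rintro ⟨hf, h⟩
    refine ⟨hf, fun B hB hfB => hB ?_⟩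
    have hm : Mono (f ≫ cokernel.π B.arrow) := by
      rw [mono_comp_cokernel_π_iff]
      intro T s t hst
      have : (Subobject.mk f ⊓ B).Factors (t ≫ f) := by
        rw [Subobject.inf_factors]
        refine ⟨(Subobject.mk_factors_iff f _).2 ⟨t, rfl⟩, ?_⟩
        rw [hst]
        exact Subobject.factors_comp_arrow s
      rw [hfB, Subobject.bot_factors_iff_zero] at this
      exact zero_of_comp_mono f this
    have := h _ hm
    have h0 : B.arrow = 0 := by
      rw [← cancel_mono (cokernel.π B.arrow), cokernel.condition, zero_comp]
    rwa [← Subobject.mk_arrow B, Subobject.mk_eq_bot_iff_zero]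

theorem IsEssentialMono.comp_isIso {A E E' : C} {f : A ⟶ E} (h : IsEssentialMono f) (g : E ⟶ E')
    [IsIso g] : IsEssentialMono (f ≫ g) := by
  rw [isEssentialMono_iff] at h ⊢
  have := h.1
  refine ⟨inferInstance, fun Z k hk => ?_⟩
  rw [Category.assoc] at hk
  have := h.2 _ hk
  rw [← IsIso.inv_hom_id_assoc g k]
  infer_instance

/-- Two injective hulls of the same object are isomorphic. -/
theorem IsInjectiveHull.nonempty_iso {A E E' : C} (h : IsInjectiveHull A E)
    (h' : IsInjectiveHull A E') : Nonempty (E ≅ E') := by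
  obtain ⟨hE, f, hf⟩ := h
  obtain ⟨hE', f', hf'⟩ := h'
  rw [isEssentialMono_iff] at hf hf'
  have := hf.1
  have := hf'.1
  have hg : Mono (Injective.factorThru f' f) := hf.2 _ (by rw [Injective.comp_factorThru]; exact hf'.1)
  set g := Injective.factorThru f' f with hgdef
  have hfg : f ≫ g = f' := Injective.comp_factorThru _ _
  have hr : g ≫ Injective.factorThru (𝟙 E) g = 𝟙 E := Injective.comp_factorThru _ _
  have : Mono (Injective.factorThru (𝟙 E) g) := hf'.2 _ (by
    rw [← hfg, Category.assoc, hr, Category.comp_id]; exact hf.1)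
  refine ⟨⟨g, Injective.factorThru (𝟙 E) g, hr, ?_⟩⟩
  rw [← cancel_mono (Injective.factorThru (𝟙 E) g), Category.assoc, hr]
  simp

/-- A nonzero retract of an indecomposable object is the whole object. -/
theorem CategoryTheory.Indecomposable.isIso_of_retract {E I : C} (hI : Indecomposable I) (hE : ¬ IsZero E)
    (s : E ⟶ I) (r : I ⟶ E) (h : s ≫ r = 𝟙 E) : IsIso s := by
  let S : ShortComplex C := ShortComplex.mk (kernel.ι r) r (kernel.condition r)
  let σ : S.Splitting :=
    { r := kernel.lift r (𝟙 I - r ≫ s) (by rw [Preadditive.sub_comp, Category.assoc, h, Category.comp_id]; exact sub_eq_zero.2 (Category.id_comp r))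
      s := s
      f_r := by
        rw [← cancel_mono (kernel.ι r)]
        simp [S]
      s_g := h
      id := by simp [S] }
  -- The splitting gives I ≅ ker r ⊞ E with E nonzero, so indecomposability forces ker r = 0.
  have hr : Mono r := by
    have h0 := (hI.2 _ _ σ.isoBinaryBiproduct).resolve_right hE
    exact Preadditive.mono_of_kernel_zero (h0.eq_of_src _ _)
  refine ⟨r, h, ?_⟩
  rw [← cancel_mono r, Category.assoc, h]
  simp

/-! ### Existence of injective hulls -/

variable [IsGrothendieckAbelian.{w} C]

attribute [local instance] IsFiltered.isConnected in
-- Zorn's lemma: the union of a chain is a filtered colimit, and filtered colimits preserve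
-- monomorphisms.
theorem exists_maximal_mono_arrow_comp {X Q : C} (q : X ⟶ Q) (S : Subobject X)
    (hS : Mono (S.arrow ≫ q)) : ∃ M, S ≤ M ∧ Mono (M.arrow ≫ q) ∧
      ∀ T, M ≤ T → Mono (T.arrow ≫ q) → T ≤ M := by
  obtain ⟨M, hSM, hM⟩ := zorn_le_nonempty₀ {T : Subobject X | Mono (T.arrow ≫ q)} (by
    intro c hc hchain y hy
    have hne : Nonempty c := ⟨⟨y, hy⟩⟩
    have : IsDirectedOrder c := ⟨fun a b => by
      rcases hchain.total a.2 b.2 with h | h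
      · exact ⟨b, h, le_rfl⟩
      · exact ⟨a, le_rfl, h⟩⟩
    let J := Shrink.{w} c
    let _ : SmallCategory J := Preorder.smallCategory J
    let e : c ≃o J := orderIsoShrink c
    have : Nonempty J := ⟨e ⟨y, hy⟩⟩
    have : IsDirectedOrder J := ⟨fun a b => by
      obtain ⟨z, hz⟩ := exists_ge_ge (e.symm a) (e.symm b)
      exact ⟨e z, (e.symm_apply_le).1 hz.1, (e.symm_apply_le).1 hz.2⟩⟩
    have hmono : Monotone fun j : J => (e.symm j).1 := fun a b hab => e.symm.monotone hab
    let K : J ⥤ C := 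
      { obj j := ((e.symm j).1 : C)
        map f := Subobject.ofLE _ _ (hmono (leOfHom f))
        map_id _ := Subobject.ofLE_refl _
        map_comp _ _ := (Subobject.ofLE_comp_ofLE _ _ _ _ _).symm }
    have key : ∀ {Z : C} (f : X ⟶ Z), (∀ T ∈ c, Mono (T.arrow ≫ f)) →
        ∃ g : colimit K ⟶ Z, Mono g ∧ ∀ j, colimit.ι K j ≫ g = (e.symm j).1.arrow ≫ f := by
      intro Z f hf
      let α : K ⟶ (Functor.const J).obj Z :=
        { app j := (e.symm j).1.arrow ≫ f
          naturality a b h := by simp [K] }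
      have hα : ∀ j, Mono (α.app j) := fun j => hf _ (e.symm j).2
      have := NatTrans.mono_of_mono_app α
      refine ⟨colimit.desc K ⟨Z, α⟩, ?_, fun j => colimit.ι_desc _ _⟩
      exact colim.map_mono' α (colimit.isColimit K) (isColimitConstCocone J Z) _
        fun j => (colimit.ι_desc _ _).trans (Category.comp_id _).symm
    -- With the identity, the colimit becomes a subobject of X; with q, its composite to Q is seen
    -- to be monic.
    obtain ⟨g, hg, hgι⟩ := key (𝟙 X) fun T _ => by rw [Category.comp_id]; infer_instance
    obtain ⟨g', hg', hgι'⟩ := key q hc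
    have hgg : g ≫ q = g' := by
      ext j
      rw [hgι', ← Category.assoc, hgι, Category.comp_id]
    refine ⟨Subobject.mk g, ?_, fun T hT => ?_⟩
    · change Mono ((Subobject.mk g).arrow ≫ q)
      rw [← Subobject.underlyingIso_hom_comp_eq_mk, Category.assoc, hgg]
      infer_instance
    · have hle : ∀ j, (e.symm j).1 ≤ Subobject.mk g := fun j =>
        Subobject.le_mk_of_comm (colimit.ι K j) ((hgι j).trans (Category.comp_id _))
      have := hle (e ⟨T, hT⟩)
      rwa [e.symm_apply_apply] at this) S hS
  exact ⟨M, hSM, hM.1, fun T hMT hT => hM.2 hT hMT⟩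

/-- A subobject of an injective object has an injective hull which is a retract of that object. -/
theorem exists_isEssentialMono_retract {A I : C} [Injective I] (i : A ⟶ I) [Mono i] :
    ∃ (E : C) (a : A ⟶ E) (s : E ⟶ I) (r : I ⟶ E),
      s ≫ r = 𝟙 E ∧ a ≫ s = i ∧ IsEssentialMono a := by
  -- K is a maximal subobject of I meeting A trivially.
  obtain ⟨K, -, hK, hKmax⟩ := exists_maximal_mono_arrow_comp (cokernel.π i) ⊥
    ((mono_comp_cokernel_π_iff i _).2 fun T s t _ => by
      rw [← cancel_mono (⊥ : Subobject I).arrow, Subobject.bot_arrow]; simp)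
  have hiK : Mono (i ≫ cokernel.π K.arrow) :=
    (mono_comp_cokernel_π_iff _ _).2 fun T s t hst => by
      have h0 : s = 0 := (mono_comp_cokernel_π_iff i K.arrow).1 hK t s hst.symm
      rw [← cancel_mono i, hst, h0]; simp
  -- A ⟶ I/K is essential: if it stays monic after g, the kernel of I ⟶ Z contains K and meets A
  -- trivially, so it is K.
  have hess : ∀ ⦃Z : C⦄ (g : cokernel K.arrow ⟶ Z), Mono ((i ≫ cokernel.π K.arrow) ≫ g) → Mono g := by
    intro Z g hg
    have hle : kernelSubobject (cokernel.π K.arrow ≫ g) ≤ K := by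
      refine hKmax _ (le_kernelSubobject _ _ (by simp)) ?_
      refine (mono_comp_cokernel_π_iff i _).2 fun T s t hst => ?_
      have h0 : s = 0 := by
        rw [← cancel_mono ((i ≫ cokernel.π K.arrow) ≫ g)]
        simp only [Category.assoc]
        rw [← reassoc_of% hst, kernelSubobject_arrow_comp]
        simp
      rw [← cancel_mono (kernelSubobject (cokernel.π K.arrow ≫ g)).arrow, hst, h0]
      simp
    refine Preadditive.mono_of_cancel_zero _ fun {T} t ht => ?_
    obtain ⟨T', π, hπ, y, hy⟩ := surjective_up_to_refinements_of_epi (cokernel.π K.arrow) t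
    have hyK : K.Factors y := Subobject.factors_of_le _ hle
      ((kernelSubobject_factors_iff _ _).2 (by rw [← reassoc_of% hy, ht, comp_zero]))
    rw [← cancel_epi π, hy, ← K.factorThru_arrow y hyK, Category.assoc, cokernel.condition,
      comp_zero, comp_zero]
  -- E contains A and is maximal among subobjects meeting K trivially.
  obtain ⟨E, hiE, hE, hEmax⟩ := exists_maximal_mono_arrow_comp (cokernel.π K.arrow)
    (Subobject.mk i) (by
      rw [← Subobject.underlyingIso_hom_comp_eq_mk, Category.assoc]
      infer_instance)
  let u := E.arrow ≫ cokernel.π K.arrow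
  let a : A ⟶ (E : C) := Subobject.ofMkLE i E hiE
  have ha : a ≫ E.arrow = i := Subobject.ofMkLE_arrow _
  let g : cokernel K.arrow ⟶ I := Injective.factorThru E.arrow u
  have hug : u ≫ g = E.arrow := Injective.comp_factorThru _ _
  have hiug : (i ≫ cokernel.π K.arrow) ≫ g = i := by
    conv_lhs => rw [← ha]
    simp only [Category.assoc]
    have : E.arrow ≫ cokernel.π K.arrow ≫ g = E.arrow := by rw [← Category.assoc]; exact hug
    rw [this, ha]
  -- Both g and its composite back to I/K are monic on A, hence monic. So the image of g contains E
  -- and meets K trivially; it equals E, and u is invertible.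
  have hg : Mono g := hess g (by rw [hiug]; infer_instance)
  have hgK : Mono (g ≫ cokernel.π K.arrow) := hess _ (by rw [← Category.assoc, hiug]; exact hiK)
  have hgE : Subobject.mk g ≤ E := by
    refine hEmax _ ?_ ?_
    · exact Subobject.le_mk_of_comm u hug
    · rw [← Subobject.underlyingIso_hom_comp_eq_mk, Category.assoc]
      infer_instance
  let k : cokernel K.arrow ⟶ (E : C) := Subobject.ofMkLE g E hgE
  have hk : k ≫ E.arrow = g := Subobject.ofMkLE_arrow _
  have huk : u ≫ k = 𝟙 (E : C) := by
    rw [← cancel_mono E.arrow, Category.assoc, hk, hug, Category.id_comp]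
  refine ⟨E, a, E.arrow, cokernel.π K.arrow ≫ k, by rw [← Category.assoc]; exact huk, ha, ?_⟩
  have hkm : Mono k := by
    have : Mono (k ≫ E.arrow) := by rw [hk]; exact hg
    exact mono_of_mono k E.arrow
  have hiso : IsIso u := ⟨k, huk, by rw [← cancel_mono k, Category.assoc, huk]; simp⟩
  have : IsEssentialMono (i ≫ cokernel.π K.arrow) := (isEssentialMono_iff _).2 ⟨hiK, hess⟩
  have := this.comp_isIso (inv u)
  convert this using 1
  rw [IsIso.eq_comp_inv, ← ha]
  simp [u]

theorem exists_isInjectiveHull (A : C) : ∃ E : C, IsInjectiveHull A E := by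
  obtain ⟨E, a, s, r, hsr, -, ha⟩ := exists_isEssentialMono_retract (Injective.ι A)
  exact ⟨E, injective_of_retract s r hsr, a, ha⟩

/-- An indecomposable injective object is an injective hull of each of its nonzero subobjects. -/
theorem CategoryTheory.Indecomposable.isInjectiveHull {A I : C} (hI : Indecomposable I) [Injective I]
    (hA : ¬ IsZero A) (i : A ⟶ I) [Mono i] : IsInjectiveHull A I := by
  obtain ⟨E, a, s, r, hsr, has, ha⟩ := exists_isEssentialMono_retract i
  have ham := ha.1
  have hE : ¬ IsZero E := fun h => hA (IsZero.of_mono a h)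
  have := hI.isIso_of_retract hE s r hsr
  exact ⟨inferInstance, i, has ▸ ha.comp_isIso s⟩

end

/-! ### Critical composition series and indecomposable injectives -/

section

theorem LTSeries.exists_deviationGE {L : Type*} [Lattice L] [IsModularLattice L]
    {α : Ordinal.{w}} (s : LTSeries L) (h : DeviationGE α (Set.Icc s.head s.last)) :
    ∃ i : Fin s.length, DeviationGE α (Set.Icc (s i.castSucc) (s i.succ)) := by
  by_contra! hcon
  have : ∀ j, ¬ DeviationGE α (Set.Icc s.head (s j)) := by
    intro j
    induction j using Fin.induction with
    | zero => exact fun h => h.lt_of_Icc.ne rfl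
    | succ i ih => exact fun h =>
        (h.Icc_or (s.monotone (Fin.zero_le _)) (s.step i).le).elim ih (hcon i)
  exact this _ h

variable {C : Type u} [Category.{v} C] [Abelian C]

/-- Two nonzero summands of E would each meet F nontrivially, so by uniformity they would meet each
other. -/
theorem IsCriticalOfDim.indecomposable {F E : C} {α : Ordinal.{max u v}}
    (hF : IsCriticalOfDim α F) {f : F ⟶ E} (hf : IsEssentialMono f) : Indecomposable E := by
  obtain ⟨hfm, hess⟩ := hf
  refine ⟨fun hE => hF.1 (IsZero.of_mono f hE), fun Y Z e => ?_⟩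
  by_contra! hcon
  have ne : ∀ {W : C} (j : W ⟶ E) [Mono j], ¬ IsZero W → ⊥ < Subobject.mk f ⊓ Subobject.mk j := by
    intro W j _ hW
    refine bot_lt_iff_ne_bot.2 (hess _ fun h0 => hW ?_)
    rw [Subobject.mk_eq_bot_iff_zero] at h0
    exact IsZero.of_mono_eq_zero j h0
  have h := ((isCriticalOfDim_iff_mk f).1 hF).lt_inf (ne (biprod.inl ≫ e.inv) hcon.1) inf_le_left
    (ne (biprod.inr ≫ e.inv) hcon.2) inf_le_left
  refine h.not_ge ?_
  have hle := inf_le_inf (inf_le_right : Subobject.mk f ⊓ Subobject.mk (biprod.inl ≫ e.inv) ≤ _)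
    (inf_le_right : Subobject.mk f ⊓ Subobject.mk (biprod.inr ≫ e.inv) ≤ _)
  refine hle.trans (le_of_eq ?_)
  set S := Subobject.mk (biprod.inl ≫ e.inv) ⊓ Subobject.mk (biprod.inr ≫ e.inv) with hS
  have h1 := Subobject.inf_arrow_factors_left (Subobject.mk (biprod.inl ≫ e.inv))
    (Subobject.mk (biprod.inr ≫ e.inv))
  have h2 := Subobject.inf_arrow_factors_right (Subobject.mk (biprod.inl ≫ e.inv))
    (Subobject.mk (biprod.inr ≫ e.inv))
  obtain ⟨a, ha⟩ := (Subobject.mk_factors_iff _ _).1 h1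
  obtain ⟨b, hb⟩ := (Subobject.mk_factors_iff _ _).1 h2
  change _ ⟶ Y at a
  change _ ⟶ Z at b
  replace ha : a ≫ biprod.inl ≫ e.inv = S.arrow := ha
  replace hb : b ≫ biprod.inr ≫ e.inv = S.arrow := hb
  have h0 : a = 0 := by
    have := congrArg (· ≫ e.hom ≫ biprod.fst) (ha.trans hb.symm)
    simpa using this
  rw [← Subobject.mk_arrow S, Subobject.mk_eq_bot_iff_zero, ← ha, h0, zero_comp]

theorem IsCriticalOfDim.criticalDim_eq {F E : C} {α : Ordinal.{max u v}}
    (hF : IsCriticalOfDim α F) {f : F ⟶ E} (hf : IsEssentialMono f) :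
    criticalDim E = ((α : WithTop Ordinal.{max u v}) : WithBot (WithTop Ordinal.{max u v})) := by
  obtain ⟨hfm, hess⟩ := hf
  have hcrit := (isCriticalOfDim_iff_mk f).1 hF
  have hne : Subobject.mk f ≠ ⊥ := hcrit.1.lt_of_Icc.ne'
  apply le_antisymm
  · refine (criticalDim_le (Subobject.mk f) hne).trans (le_of_eq ?_)
    have : IsCriticalOfDim α (Subobject.mk f : C) := by
      rwa [isCriticalOfDim_iff_mk (Subobject.mk f).arrow, Subobject.mk_arrow]
    exact this.2.1
  · obtain ⟨B, hB, hBdim⟩ := exists_grKrullDim_eq_criticalDim _ hne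
    -- B meets F in a nonzero subobject of F, which already has the full deviation α.
    rw [← hBdim, coe_le_grKrullDim_iff B.arrow, Subobject.mk_arrow]
    exact (hcrit.deviationGE (bot_lt_iff_ne_bot.2 (hess B hB)) inf_le_left).of_Icc_subset le_rfl
      inf_le_right

/-- A nonzero morphism from an `α`-critical object to an object of critical dimension at least `α`
is a monomorphism. -/
theorem IsCriticalOfDim.mono_of_ne_zero {F E : C} {α : Ordinal.{max u v}}
    (hF : IsCriticalOfDim α F)
    (hE : ((α : WithTop Ordinal.{max u v}) : WithBot (WithTop Ordinal.{max u v})) ≤ criticalDim E)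
    {g : F ⟶ E} (hg : g ≠ 0) : Mono g := by
  have hne : imageSubobject g ≠ ⊥ := fun h0 => hg <| by
    have := imageSubobject_factors_comp_self g (𝟙 F)
    rwa [h0, Subobject.bot_factors_iff_zero, Category.id_comp] at this
  -- The image is a nonzero subobject of E, so F/ker g has deviation at least α, which criticality
  -- allows only for a zero kernel.
  have hdev := coe_le_deviation_iff.1 (hE.trans (criticalDim_le _ hne))
  rw [deviationGE_congr (Subobject.orderIsoIciKernel (factorThruImageSubobject g))] at hdev
  have hker : kernelSubobject (factorThruImageSubobject g) = ⊥ := by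
    by_contra hk
    refine (isCriticalOfDim_iff.1 hF).2 _ (bot_lt_iff_ne_bot.2 hk) le_top ?_
    exact hdev.of_strictMono (g := fun x => ⟨x.1, x.2, le_top⟩) fun _ _ h => h
  refine Preadditive.mono_of_cancel_zero _ fun {T} t ht => ?_
  rw [← Subobject.bot_factors_iff_zero, ← hker, kernelSubobject_factors_iff,
    ← cancel_mono (imageSubobject g).arrow, Category.assoc, imageSubobject_arrow_comp, ht, zero_comp]

/-- A nonzero morphism from an object with a chain of subobjects induces a nonzero morphism from
one of the factors. -/
theorem exists_seriesFactor_hom_ne_zero {G E : C} {h : G ⟶ E} (hh : h ≠ 0)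
    {s : LTSeries (Subobject G)} (h0 : s.head = ⊥) (h1 : s.last = ⊤) :
    ∃ (i : Fin s.length) (g : seriesFactor s i ⟶ E), g ≠ 0 := by
  -- The restriction of h vanishes at the bottom and not at the top, so it becomes nonzero at some
  -- step and descends to that factor.
  have hex : ∃ i : Fin s.length, (s i.castSucc).arrow ≫ h = 0 ∧ (s i.succ).arrow ≫ h ≠ 0 := by
    by_contra! hcon
    have : ∀ j, (s j).arrow ≫ h = 0 := by
      intro j
      induction j using Fin.induction with
      | zero =>
        change s.head.arrow ≫ h = 0
        rw [h0, Subobject.bot_arrow, zero_comp]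
      | succ i ih => exact hcon i ih
    have hlast : s.last.arrow ≫ h = 0 := this _
    rw [h1] at hlast
    exact hh (zero_of_epi_comp _ hlast)
  obtain ⟨i, hi, hi'⟩ := hex
  refine ⟨i, cokernel.desc _ ((s i.succ).arrow ≫ h) (by simpa using hi), fun hz => hi' ?_⟩
  rw [← cokernel.π_desc (Subobject.ofLE (s i.castSucc) (s i.succ) (s.step i).le)
    ((s i.succ).arrow ≫ h) (by simpa using hi), hz]
  exact comp_zero

theorem exists_isCriticalCompositionSeries (G : C) [IsNoetherianObject G] :
    ∃ s : LTSeries (Subobject G), IsCriticalCompositionSeries s := by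
  obtain ⟨s, α, h0, h1, hs, hα⟩ := exists_critical_series (Subobject G)
  have hcrit : ∀ i, IsCriticalOfDim (α i) (seriesFactor s i) := fun i =>
    isCriticalOfDim_seriesFactor_iff.2 (hs i)
  refine ⟨s, h0, h1, fun i => ⟨_, hcrit i⟩, fun i j hij => ?_⟩
  change grKrullDim _ ≤ grKrullDim _
  rw [(hcrit i).2.1, (hcrit j).2.1, WithBot.coe_le_coe, WithTop.coe_le_coe]
  exact hα hij

theorem IsCriticalOfDim.le_of_seriesFactor {G : C} {s : LTSeries (Subobject G)} {i : Fin s.length}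
    {γ d : Ordinal.{max u v}} (hγ : IsCriticalOfDim γ (seriesFactor s i))
    (hd : ¬ DeviationGE (d + 1) (Subobject G)) : γ ≤ d := by
  by_contra hlt
  refine hd (DeviationGE.mono (Order.add_one_le_iff.2 (not_le.1 hlt)) ?_)
  exact (isCriticalOfDim_seriesFactor_iff.1 hγ).1.of_strictMono (g := Subtype.val) fun _ _ h => h

end

theorem mainTheorem2 {C : Type u} [Category.{v} C] [Abelian C] [IsGrothendieckAbelian.{w} C]
    (G : C) (hG : IsNoetherianGenerator G) (hG0 : ¬ IsZero G) :
    ∃ d : Ordinal.{max u v},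
      grKrullDim G = ((d : WithTop Ordinal.{max u v}) : WithBot (WithTop Ordinal.{max u v})) ∧
      -- at least one and only finitely many indecomposable injectives of critical dimension `d`
      (injSpecOfCriticalDim C d).Nonempty ∧ (injSpecOfCriticalDim C d).Finite ∧
      -- they are the hulls of the `d`-dimensional factors of any critical composition series
      (∃ s : LTSeries (Subobject G), IsCriticalCompositionSeries s) ∧
      ∀ s : LTSeries (Subobject G), IsCriticalCompositionSeries s →
        (∀ i : Fin s.length,
          grKrullDim (seriesFactor s i) =
              ((d : WithTop Ordinal.{max u v}) : WithBot (WithTop Ordinal.{max u v})) →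
            ∃ E : C, IsInjectiveHull (seriesFactor s i) E) ∧
        ∀ E : C,
          (Indecomposable E ∧ Injective E ∧
            criticalDim E =
              ((d : WithTop Ordinal.{max u v}) : WithBot (WithTop Ordinal.{max u v}))) ↔
          ∃ i : Fin s.length,
            grKrullDim (seriesFactor s i) =
                ((d : WithTop Ordinal.{max u v}) : WithBot (WithTop Ordinal.{max u v})) ∧
              IsInjectiveHull (seriesFactor s i) E := by
  have := hG.isNoetherianObject
  have := Subobject.nontrivial_of_not_isZero hG0
  obtain ⟨d, hd, hd'⟩ := exists_deviationGE_not_succ (P := Subobject G) ⟨⊥, ⊤, bot_lt_top⟩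
    (exists_not_deviationGE (Subobject G))
  have main : ∀ s : LTSeries (Subobject G), IsCriticalCompositionSeries s → ∀ E : C,
      (Indecomposable E ∧ Injective E ∧
        criticalDim E =
          ((d : WithTop Ordinal.{max u v}) : WithBot (WithTop Ordinal.{max u v}))) ↔
      ∃ i : Fin s.length,
        grKrullDim (seriesFactor s i) =
            ((d : WithTop Ordinal.{max u v}) : WithBot (WithTop Ordinal.{max u v})) ∧
          IsInjectiveHull (seriesFactor s i) E := by
    intro s hs E
    constructor
    · rintro ⟨hE, hEinj, hEd⟩
      have hex : ∃ h : G ⟶ E, h ≠ 0 := by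
        by_contra! hcon
        exact hE.1 ((IsZero.iff_id_eq_zero E).2 ((Preadditive.isSeparator_iff G).1 hG.isSeparator _
          fun h => by rw [Category.comp_id, hcon h]))
      obtain ⟨h, hh⟩ := hex
      obtain ⟨i, g, hg⟩ := exists_seriesFactor_hom_ne_zero hh hs.head_eq hs.last_eq
      obtain ⟨γ, hγ⟩ := hs.critical i
      have hγd := hγ.le_of_seriesFactor hd'
      have hgm : Mono g := hγ.mono_of_ne_zero
        (by rw [hEd, WithBot.coe_le_coe, WithTop.coe_le_coe]; exact hγd) hg
      have hull := hE.isInjectiveHull hγ.1 g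
      obtain ⟨-, f, hf⟩ := hull
      refine ⟨i, ?_, hE.isInjectiveHull hγ.1 g⟩
      -- Being a hull of a γ-critical object, E has critical dimension γ, whence γ = d.
      rw [hγ.2.1, ← hγ.criticalDim_eq hf, hEd]
    · rintro ⟨i, hi, hEinj, f, hf⟩
      obtain ⟨γ, hγ⟩ := hs.critical i
      exact ⟨hγ.indecomposable hf, hEinj, (hγ.criticalDim_eq hf).trans (hγ.2.1.symm.trans hi)⟩
  obtain ⟨s, hs⟩ := exists_isCriticalCompositionSeries G
  refine ⟨d, (deviation_eq_iff _ _).2 ⟨hd, hd'⟩, ?_, ?_, ⟨s, hs⟩,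
    fun s hs => ⟨fun i _ => exists_isInjectiveHull _, main s hs⟩⟩
  · have hdev : DeviationGE d (Set.Icc s.head s.last) := by
      rw [hs.head_eq, hs.last_eq]
      exact hd.of_strictMono (g := fun x => ⟨x, bot_le, le_top⟩) fun _ _ h => h
    obtain ⟨i, hi⟩ := s.exists_deviationGE hdev
    obtain ⟨γ, hγ⟩ := hs.critical i
    have hγd : grKrullDim (seriesFactor s i) =
        ((d : WithTop Ordinal.{max u v}) : WithBot (WithTop Ordinal.{max u v})) := by
      refine le_antisymm ?_ (coe_le_deviation_iff.2
        ((deviationGE_congr (Subobject.orderIsoIccCokernel (s.step i).le)).2 hi))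
      rw [hγ.2.1, WithBot.coe_le_coe, WithTop.coe_le_coe]
      exact hγ.le_of_seriesFactor hd'
    obtain ⟨E, hE⟩ := exists_isInjectiveHull (seriesFactor s i)
    obtain ⟨h1, h2, h3⟩ := (main s hs E).2 ⟨i, hγd, hE⟩
    exact ⟨_, E, h1, h2, h3, rfl⟩
  · refine (Set.finite_iUnion (f := fun i : Fin s.length =>
      {x | ∃ E : C, IsInjectiveHull (seriesFactor s i) E ∧
        Quotient.mk (isIsomorphicSetoid C) E = x}) fun i => Set.Subsingleton.finite ?_).subset ?_
    · rintro _ ⟨E, hE, rfl⟩ _ ⟨E', hE', rfl⟩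
      exact Quotient.sound (hE.nonempty_iso hE')
    · rintro _ ⟨E, h1, h2, h3, rfl⟩
      obtain ⟨i, -, hi⟩ := (main s hs E).1 ⟨h1, h2, h3⟩
      exact Set.mem_iUnion.2 ⟨i, E, hi, rfl⟩
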